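/- Consider $n\ge 2$ deterministic asynchronous processes with unique identifiers, each starting with an input (proposed) value from $\{0,1\}$, which communicate either by atomically reading and writing shared registers, or by sending and receiving messages over reliable channels with unbounded delays. A process crashes if it halts prematurely, i.e. takes only finitely many steps without deciding; deciding terminates a process. An algorithm solves the $t$-resilient $(n,k)$-partial agreement problem if in every execution (i) there is a value $v$ which is the input of at least one process and such that at most $n-k$ processes decide on values other than $v$, and (ii) if at most $t$ processes crash, then every process that does not crash eventually decides (and terminates). Under strong validity it is required in addition that every decided value is the input of some process; otherwise one speaks of weak validity. Theorem. Let $n\ge 2$, $t\ge 1$ and $k \ge 0$ be integers. In each of the two models (read/write registers, message passing), and under each of the two validity requirements (weak, strong), there exists an algorithm solving the $t$-resilient $(n,k)$-partial agreement problem for binary inputs if and only if $k\le\lceil n/2\rceil$. Furthermore, for every $k\le\lceil n/2\rceil$ there exists, in each model and under each validity requirement, such an algorithm in which the processes do not communicate at all and each process can only decide its own input. -/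

import Mathlib

/-! ## Observable runs and the partial agreement problem (independent of the model) -/

/-- What can be observed of an execution of `n` asynchronous processes: the input values, which
process (if any) takes the `i`-th step, and which value (if any) each process has decided after
the first `i` steps. Since `mover i = none` is allowed, finite executions are included. -/
structure Run (n : ℕ) where
  input : Fin n → ℕ
  mover : ℕ → Option (Fin n)
  decided : ℕ → Fin n → Option ℕ

namespace Run

variable {n : ℕ}

/-- Process `p` decides the value `v` in the run. -/
def Decides (r : Run n) (p : Fin n) (v : ℕ) : Prop :=
  ∃ i, r.decided i p = some v

/-- Process `p` crashes, that is, halts prematurely: it takes only finitely many steps and never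
decides. (Deciding terminates a process.) -/
def Crashes (r : Run n) (p : Fin n) : Prop :=
  (∀ v, ¬ r.Decides p v) ∧ {i | r.mover i = some p}.Finite

/-- The value `v` is proposed: it is the input of at least one process. -/
def Proposed (r : Run n) (v : ℕ) : Prop :=
  ∃ p, r.input p = v

/-- At most `n - k` processes decide on values other than `v` (written without truncated
subtraction, so that it is unsatisfiable for `k > n`). -/
def Agreement (r : Run n) (k v : ℕ) : Prop :=
  {p | ∃ w, w ≠ v ∧ r.Decides p w}.ncard + k ≤ n

/-- If at most `t` processes crash, then every process that does not crash decides. -/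
def Resilient (r : Run n) (t : ℕ) : Prop :=
  {p | r.Crashes p}.ncard ≤ t → ∀ p, ¬ r.Crashes p → ∃ v, r.Decides p v

end Run

/-- The two validity requirements. -/
inductive Validity where
  /-- The decision value `v` of the run is a proposed value. -/
  | weak
  /-- Moreover, every value decided by some process is a proposed value. -/
  | strong

/-- A run with decision value `v` meets the given validity requirement. -/
def Run.Valid {n : ℕ} (r : Run n) (v : ℕ) : Validity → Prop
  | .weak => r.Proposed v
  | .strong => r.Proposed v ∧ ∀ p w, r.Decides p w → r.Proposed w

/-- `runs` is the set of runs of an algorithm for `n` processes. The algorithm solves the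
`t`-resilient `(n, k)`-partial agreement problem with the `m` possible input values
`0, …, m - 1`. -/
def SolvesPartialAgreement {n : ℕ} (runs : Set (Run n)) (m k t : ℕ) (val : Validity) : Prop :=
  ∀ r ∈ runs, (∀ p, r.input p < m) →
    (∃ v, r.Agreement k v ∧ r.Valid v val) ∧ r.Resilient t

/-- In every run, a process can only decide its own input. -/
def OnlyOwnInputDecided {n : ℕ} (runs : Set (Run n)) : Prop :=
  ∀ r ∈ runs, ∀ p v, r.Decides p v → v = r.input p

/-- Status of a process: still running in some local state, or terminated with a decision. -/
inductive Status (State : Type) where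
  | running (s : State)
  | terminated (v : ℕ)

/-- The decided value, if any. -/
def Status.decision {State : Type} : Status State → Option ℕ
  | .running _ => none
  | .terminated v => some v

/-! ## The asynchronous read/write model -/

/-- The next atomic step of a process communicating through shared registers. -/
inductive RWInstr (Reg Val State : Type) where
  /-- Atomically read register `r`; the new local state depends on the value read. -/
  | read (r : Reg) (next : Val → State)
  /-- Atomically write `x` to register `r`. -/
  | write (r : Reg) (x : Val) (next : State)
  /-- A local step. -/
  | compute (next : State)
  /-- Decide `v` and terminate. -/
  | decide (v : ℕ)

/-- A deterministic algorithm for `n` processes with atomic multi-writer multi-reader registers.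
The code of a process may depend on its identifier. -/
structure RWAlgorithm (n : ℕ) where
  Reg : Type
  Val : Type
  State : Type
  /-- initial contents of the registers -/
  regInit : Reg → Val
  /-- initial local state of a process proposing a given value -/
  start : Fin n → ℕ → State
  /-- the code -/
  code : Fin n → State → RWInstr Reg Val State

namespace RWAlgorithm

variable {n : ℕ}

/-- A global configuration. -/
structure Config (A : RWAlgorithm n) where
  status : Fin n → Status A.State
  mem : A.Reg → A.Val

/-- The initial configuration. -/
def initial (A : RWAlgorithm n) (input : Fin n → ℕ) : A.Config where
  status p := .running (A.start p (input p))
  mem := A.regInit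

open Classical in
/-- One step of process `p`; nothing happens if `p` has terminated. -/
noncomputable def step (A : RWAlgorithm n) (p : Fin n) (c : A.Config) : A.Config :=
  match c.status p with
  | .terminated _ => c
  | .running s =>
    match A.code p s with
    | .read r next => ⟨Function.update c.status p (.running (next (c.mem r))), c.mem⟩
    | .write r x next =>
        ⟨Function.update c.status p (.running next), Function.update c.mem r x⟩
    | .compute next => ⟨Function.update c.status p (.running next), c.mem⟩
    | .decide v => ⟨Function.update c.status p (.terminated v), c.mem⟩

/-- The configuration after the first `i` entries of an arbitrary schedule `σ`. -/
noncomputable def exec (A : RWAlgorithm n) (input : Fin n → ℕ) (σ : ℕ → Option (Fin n)) :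
    ℕ → A.Config
  | 0 => A.initial input
  | i + 1 =>
    match σ i with
    | none => A.exec input σ i
    | some p => A.step p (A.exec input σ i)

/-- The run given by an input assignment and a schedule. -/
noncomputable def run (A : RWAlgorithm n) (input : Fin n → ℕ) (σ : ℕ → Option (Fin n)) :
    Run n where
  input := input
  mover := σ
  decided i p := ((A.exec input σ i).status p).decision

/-- All runs: every schedule is possible (full asynchrony, arbitrary crashes). -/
def runs (A : RWAlgorithm n) : Set (Run n) :=
  {r | ∃ input σ, r = A.run input σ}

/-- The processes never access a shared register. -/
def NoCommunication (A : RWAlgorithm n) : Prop :=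
  ∀ p s, (∃ next, A.code p s = .compute next) ∨ (∃ v, A.code p s = .decide v)

end RWAlgorithm

/-! ## The asynchronous message-passing model -/

/-- The next atomic step of a process communicating by messages. -/
inductive MPInstr (n : ℕ) (Msg State : Type) where
  /-- Send to each process `q` the message `out q`, if any (so a single message and a broadcast
  are both possible). -/
  | send (out : Fin n → Option Msg) (next : State)
  /-- Try to receive a message; the outcome is `none`, or a message with its sender. -/
  | receive (next : Option (Fin n × Msg) → State)
  /-- A local step. -/
  | compute (next : State)
  /-- Decide `v` and terminate. -/
  | decide (v : ℕ)

/-- A deterministic algorithm for `n` processes with message passing.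
The code of a process may depend on its identifier. -/
structure MPAlgorithm (n : ℕ) where
  Msg : Type
  State : Type
  /-- initial local state of a process proposing a given value -/
  start : Fin n → ℕ → State
  /-- the code -/
  code : Fin n → State → MPInstr n Msg State

namespace MPAlgorithm

variable {n : ℕ}

/-- A global configuration: `buffer q` holds the messages, with their senders, that were sent to
`q` and are not yet received. -/
structure Config (A : MPAlgorithm n) where
  status : Fin n → Status A.State
  buffer : Fin n → Multiset (Fin n × A.Msg)

/-- The initial configuration. -/
def initial (A : MPAlgorithm n) (input : Fin n → ℕ) : A.Config where
  status p := .running (A.start p (input p))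
  buffer _ := 0

/-- Process `p` is about to execute a receive instruction. -/
def AtReceive (A : MPAlgorithm n) (c : A.Config) (p : Fin n) : Prop :=
  ∃ s next, c.status p = .running s ∧ A.code p s = .receive next

open Classical in
/-- One step of process `p`; nothing happens if `p` has terminated. If the step is a receive, the
scheduler's choice `x` is the message to be delivered; nothing is received if `x = none` or if the
chosen message is not in transit to `p`. In other steps `x` plays no role. -/
noncomputable def step (A : MPAlgorithm n) (p : Fin n) (x : Option (Fin n × A.Msg))
    (c : A.Config) : A.Config :=
  match c.status p with
  | .terminated _ => c
  | .running s =>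
    match A.code p s with
    | .send out next =>
        ⟨Function.update c.status p (.running next),
          fun q => (out q).elim (c.buffer q) fun msg => (p, msg) ::ₘ c.buffer q⟩
    | .receive next =>
        match x with
        | none => ⟨Function.update c.status p (.running (next none)), c.buffer⟩
        | some y =>
            if y ∈ c.buffer p then
              ⟨Function.update c.status p (.running (next (some y))),
                Function.update c.buffer p ((c.buffer p).erase y)⟩
            else ⟨Function.update c.status p (.running (next none)), c.buffer⟩
    | .compute next => ⟨Function.update c.status p (.running next), c.buffer⟩
    | .decide v => ⟨Function.update c.status p (.terminated v), c.buffer⟩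

/-- A schedule: who takes the `i`-th step, if anyone, and which message is offered to it. -/
abbrev Schedule (A : MPAlgorithm n) : Type :=
  ℕ → Option (Fin n × Option (Fin n × A.Msg))

/-- The configuration after the first `i` entries of the schedule `σ`. -/
noncomputable def exec (A : MPAlgorithm n) (input : Fin n → ℕ) (σ : A.Schedule) : ℕ → A.Config
  | 0 => A.initial input
  | i + 1 =>
    match σ i with
    | none => A.exec input σ i
    | some (p, x) => A.step p x (A.exec input σ i)

/-- Reliable channels: if `p` executes receive instructions infinitely often, then every message
in transit to `p` is eventually received by `p`. There is no bound on the delay, and messages may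
overtake each other. -/
def ReliableDelivery (A : MPAlgorithm n) (input : Fin n → ℕ) (σ : A.Schedule) : Prop :=
  ∀ p, {i | ∃ x, σ i = some (p, x) ∧ A.AtReceive (A.exec input σ i) p}.Infinite →
    ∀ i, ∀ y ∈ (A.exec input σ i).buffer p,
      ∃ j, i ≤ j ∧ σ j = some (p, some y) ∧ A.AtReceive (A.exec input σ j) p ∧
        y ∈ (A.exec input σ j).buffer p

/-- The run given by an input assignment and a schedule. -/
noncomputable def run (A : MPAlgorithm n) (input : Fin n → ℕ) (σ : A.Schedule) : Run n where
  input := input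
  mover i := (σ i).map Prod.fst
  decided i p := ((A.exec input σ i).status p).decision

/-- All runs: every schedule with reliable delivery is possible. -/
def runs (A : MPAlgorithm n) : Set (Run n) :=
  {r | ∃ input σ, A.ReliableDelivery input σ ∧ r = A.run input σ}

/-- The processes never send or receive a message. -/
def NoCommunication (A : MPAlgorithm n) : Prop :=
  ∀ p s, (∃ next, A.code p s = .compute next) ∨ (∃ v, A.code p s = .decide v)

end MPAlgorithm

/-! A value proposed by at least half of the processes exists because inputs are binary. So if each
process decides its own input, at most `⌊n / 2⌋ ≤ n - k` processes deviate from it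
(`solvesPartialAgreement_of_own_input`).

For the converse let `2 * k ≥ n + 2`. Single decisions carry little information, since processes may
disagree; the idea is to regard the whole system as deciding `v` once more than `n - k` processes
have decided `v` (`RWAlgorithm.Outputs`). An output is unique and permanent, and it is a proposed
value. If all processes but one keep taking steps, these processes alone produce an output, as
`n - 1 - (n - k) > n - k` (`exists_outputs_without`). These are the only properties of consensus
that the valency argument of Fischer, Lynch and Paterson, in the form of Loui and Abu-Amara for
registers, makes use of: some initial configuration is bivalent (`exists_bivalent_initial`), and
from each bivalent configuration and each process `p` there is a bivalent continuation that ends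
with a step of `p` (`Bivalent.exists_step`), because two steps commute up to the local state of one
process (`step_step_similar`). The resulting infinite execution without crashes never outputs anything, a
contradiction (`not_solvesPartialAgreement`).

Message passing is reduced to registers. The algorithm `MPAlgorithm.simulation` replaces each step
of a message-passing algorithm by exactly one step: a send instruction by one write of the complete
history of sent messages to the own register, a receive instruction by one read of a register, the
registers being polled in turn. Its runs therefore are runs of the original algorithm
(`simulation_runs_subset`), and polling in turn is what makes the delivery reliable
(`reliableDelivery_simSchedule`). -/

/-! ### Deciding one's own input -/

theorem le_ceil_half_iff (n k : ℕ) : k ≤ ⌈(n : ℚ) / 2⌉₊ ↔ 2 * k ≤ n + 1 := by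
  rcases k with _ | j
  · simp
  · rw [Nat.succ_le_iff, Nat.lt_ceil, lt_div_iff₀ two_pos]
    norm_cast
    omega

/-- With binary inputs, some value is proposed by at least half of the processes. If processes
decide nothing but their own input, then at most half of them decide on another value. -/
theorem solvesPartialAgreement_of_own_input {n k t : ℕ} (hn : 2 ≤ n) (hk : 2 * k ≤ n + 1)
    (val : Validity) {runs : Set (Run n)} (hown : OnlyOwnInputDecided runs)
    (hdec : ∀ r ∈ runs, ∀ i p, r.mover i = some p → ∃ v, r.Decides p v) :
    SolvesPartialAgreement runs 2 k t val := by
  intro r hr hbin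
  refine ⟨?_, fun _ p hp => ?_⟩
  · have hcard (v : ℕ) : {p | r.input p = v}.ncard + {p | r.input p ≠ v}.ncard = n := by
      have := Set.ncard_add_ncard_compl {p | r.input p = v}
      rwa [Nat.card_fin] at this
    have hmaj : ∃ v, n ≤ 2 * {p | r.input p = v}.ncard := by
      have h0 := hcard 0
      have h1 : {p | r.input p ≠ 0} = {p | r.input p = 1} := by
        ext p
        have := hbin p
        simp only [Set.mem_ofPred_eq]
        omega
      rw [h1] at h0
      by_contra! h
      have := h 0
      have := h 1
      omega
    obtain ⟨v, hv⟩ := hmaj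
    have hprop : r.Proposed v := by
      have : {p | r.input p = v}.Nonempty := by
        rw [← Set.ncard_pos]
        omega
      exact this
    refine ⟨v, ?_, ?_⟩
    · have hsub : {p | ∃ w, w ≠ v ∧ r.Decides p w} ⊆ {p | r.input p ≠ v} := by
        rintro p ⟨w, hw, hd⟩
        rwa [hown r hr p w hd] at hw
      have := Set.ncard_le_ncard hsub
      have := hcard v
      unfold Run.Agreement
      omega
    · cases val
      · exact hprop
      · exact ⟨hprop, fun p w hd => ⟨p, (hown r hr p w hd).symm⟩⟩
  · by_contra! hnd
    have hinf : {i | r.mover i = some p}.Infinite := fun hfin => hp ⟨hnd, hfin⟩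
    obtain ⟨i, hi⟩ := hinf.nonempty
    obtain ⟨v, hv⟩ := hdec r hr i p hi
    exact hnd v hv

namespace Status

theorem decision_eq_some {State : Type} {s : Status State} {v : ℕ} :
    s.decision = some v ↔ s = .terminated v := by
  cases s <;> simp [decision]

end Status

namespace RWAlgorithm

/-- Every process decides its own input in its first step. -/
def ownInput (n : ℕ) : RWAlgorithm n where
  Reg := Unit
  Val := Unit
  State := ℕ
  regInit _ := ()
  start _ v := v
  code _ s := .decide s

theorem ownInput_step {n : ℕ} (p q : Fin n) (v : ℕ) (c : (ownInput n).Config)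
    (h : c.status q = .running v ∨ c.status q = .terminated v) :
    ((ownInput n).step p c).status q = if p = q then .terminated v else c.status q := by
  by_cases hpq : p = q
  · subst hpq
    rcases h with h | h <;> simp [step, ownInput, h]
  · have : q ≠ p := Ne.symm hpq
    simp only [step, hpq, if_false]
    split
    · rfl
    · simp [ownInput, this]

theorem ownInput_exec {n : ℕ} (input : Fin n → ℕ) (σ : ℕ → Option (Fin n)) (i : ℕ) (p : Fin n) :
    ((ownInput n).exec input σ i).status p = .running (input p) ∨
      ((ownInput n).exec input σ i).status p = .terminated (input p) := by
  induction i with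
  | zero => exact Or.inl rfl
  | succ i ih =>
    rw [exec]
    split
    · exact ih
    · rw [ownInput_step _ _ (input p) _ ih]
      split
      · exact Or.inr rfl
      · exact ih

theorem ownInput_noCommunication (n : ℕ) : (ownInput n).NoCommunication :=
  fun _ s => Or.inr ⟨s, rfl⟩

theorem ownInput_onlyOwnInputDecided (n : ℕ) : OnlyOwnInputDecided (ownInput n).runs := by
  rintro _ ⟨input, σ, rfl⟩ p v ⟨i, hi⟩
  rw [run, Status.decision_eq_some] at hi
  rcases ownInput_exec input σ i p with h | h <;> rw [hi] at h <;> cases h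
  rfl

theorem ownInput_solves {n k t : ℕ} (hn : 2 ≤ n) (hk : 2 * k ≤ n + 1) (val : Validity) :
    SolvesPartialAgreement (ownInput n).runs 2 k t val := by
  refine solvesPartialAgreement_of_own_input hn hk val (ownInput_onlyOwnInputDecided n) ?_
  rintro _ ⟨input, σ, rfl⟩ i p (hi : σ i = some p)
  refine ⟨input p, i + 1, ?_⟩
  rw [run, Status.decision_eq_some, exec, hi]
  exact (ownInput_step p p _ _ (ownInput_exec input σ i p)).trans (if_pos rfl)

end RWAlgorithm

namespace MPAlgorithm

/-- Every process decides its own input in its first step. -/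
def ownInput (n : ℕ) : MPAlgorithm n where
  Msg := Unit
  State := ℕ
  start _ v := v
  code _ s := .decide s

theorem ownInput_step {n : ℕ} (p q : Fin n) (v : ℕ) (x : Option (Fin n × (ownInput n).Msg))
    (c : (ownInput n).Config) (h : c.status q = .running v ∨ c.status q = .terminated v) :
    ((ownInput n).step p x c).status q = if p = q then .terminated v else c.status q := by
  by_cases hpq : p = q
  · subst hpq
    rcases h with h | h <;> simp [step, ownInput, h]
  · have : q ≠ p := Ne.symm hpq
    simp only [step, hpq, if_false]
    split
    · rfl
    · simp [ownInput, this]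

theorem ownInput_exec {n : ℕ} (input : Fin n → ℕ) (σ : (ownInput n).Schedule) (i : ℕ)
    (p : Fin n) :
    ((ownInput n).exec input σ i).status p = .running (input p) ∨
      ((ownInput n).exec input σ i).status p = .terminated (input p) := by
  induction i with
  | zero => exact Or.inl rfl
  | succ i ih =>
    rw [exec]
    split
    · exact ih
    · rw [ownInput_step _ _ (input p) _ _ ih]
      split
      · exact Or.inr rfl
      · exact ih

theorem ownInput_noCommunication (n : ℕ) : (ownInput n).NoCommunication :=
  fun _ s => Or.inr ⟨s, rfl⟩

theorem ownInput_onlyOwnInputDecided (n : ℕ) : OnlyOwnInputDecided (ownInput n).runs := by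
  rintro _ ⟨input, σ, -, rfl⟩ p v ⟨i, hi⟩
  rw [run, Status.decision_eq_some] at hi
  rcases ownInput_exec input σ i p with h | h <;> rw [hi] at h <;> cases h
  rfl

theorem ownInput_solves {n k t : ℕ} (hn : 2 ≤ n) (hk : 2 * k ≤ n + 1) (val : Validity) :
    SolvesPartialAgreement (ownInput n).runs 2 k t val := by
  refine solvesPartialAgreement_of_own_input hn hk val (ownInput_onlyOwnInputDecided n) ?_
  rintro _ ⟨input, σ, -, rfl⟩ i p (hi : (σ i).map Prod.fst = some p)
  obtain ⟨⟨p', x⟩, hx, rfl⟩ := Option.map_eq_some_iff.1 hi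
  refine ⟨input p', i + 1, ?_⟩
  rw [run, Status.decision_eq_some, exec, hx]
  exact (ownInput_step p' p' _ x _ (ownInput_exec input σ i p')).trans (if_pos rfl)

end MPAlgorithm

/-! ### Finite executions in the read/write model -/

theorem filterMap_range_length {α : Type*} {l : List α} {σ : ℕ → Option α}
    (h : ∀ i, i < l.length → σ i = l[i]?) : (List.range l.length).filterMap σ = l := by
  induction l using List.reverseRecOn with
  | nil => rfl
  | append_singleton l a ih =>
    have hl : σ l.length = some a := by simpa using h l.length (by simp)
    have := ih fun i hi =>
      (h i (hi.trans (by simp))).trans (List.getElem?_append_left hi)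
    simp [List.range_succ, this, hl]

namespace RWAlgorithm

variable {n : ℕ} {A : RWAlgorithm n}

/-- The configuration reached from `c` when the processes listed in `l` take one step each. -/
noncomputable def execList (A : RWAlgorithm n) (l : List (Fin n)) (c : A.Config) : A.Config :=
  l.foldl (fun c p => A.step p c) c

@[simp] theorem execList_nil (c : A.Config) : A.execList [] c = c := rfl

@[simp] theorem execList_cons (p : Fin n) (l : List (Fin n)) (c : A.Config) :
    A.execList (p :: l) c = A.execList l (A.step p c) := rfl

@[simp] theorem execList_append (l₁ l₂ : List (Fin n)) (c : A.Config) :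
    A.execList (l₁ ++ l₂) c = A.execList l₂ (A.execList l₁ c) :=
  List.foldl_append

theorem exec_eq_execList (input : Fin n → ℕ) (σ : ℕ → Option (Fin n)) (i : ℕ) :
    A.exec input σ i = A.execList ((List.range i).filterMap σ) (A.initial input) := by
  induction i with
  | zero => rfl
  | succ i ih =>
    rw [exec, List.range_succ, List.filterMap_append, execList_append, ← ih]
    cases h : σ i <;> simp [h]

theorem step_status_of_ne {p q : Fin n} (h : q ≠ p) (c : A.Config) :
    (A.step p c).status q = c.status q := by
  unfold step
  split
  · rfl
  · split <;> simp [h]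

theorem step_of_terminated {p : Fin n} {c : A.Config} {v : ℕ} (h : c.status p = .terminated v) :
    A.step p c = c := by
  simp [step, h]

theorem step_status_terminated {q : Fin n} {c : A.Config} {v : ℕ} (p : Fin n)
    (h : c.status q = .terminated v) : (A.step p c).status q = .terminated v := by
  by_cases hqp : q = p
  · rw [← hqp, step_of_terminated h, h]
  · rw [step_status_of_ne hqp, h]

theorem execList_status_terminated {q : Fin n} {v : ℕ} (l : List (Fin n)) {c : A.Config}
    (h : c.status q = .terminated v) : (A.execList l c).status q = .terminated v := by
  induction l generalizing c with
  | nil => exact h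
  | cons p l ih => exact ih (step_status_terminated p h)

theorem exec_status_terminated {q : Fin n} {v : ℕ} {input : Fin n → ℕ} {σ : ℕ → Option (Fin n)}
    {i j : ℕ} (hij : i ≤ j) (h : (A.exec input σ i).status q = .terminated v) :
    (A.exec input σ j).status q = .terminated v := by
  induction j, hij using Nat.le_induction with
  | base => exact h
  | succ j _ ih =>
    rw [exec]
    split
    · exact ih
    · exact step_status_terminated _ ih

/-- The configuration `c` occurs in some execution with the given inputs. -/
def Reachable (A : RWAlgorithm n) (input : Fin n → ℕ) (c : A.Config) : Prop :=
  ∃ l, A.execList l (A.initial input) = c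

theorem reachable_initial (input : Fin n → ℕ) : A.Reachable input (A.initial input) := ⟨[], rfl⟩

theorem Reachable.execList {input : Fin n → ℕ} {c : A.Config} (h : A.Reachable input c)
    (l : List (Fin n)) : A.Reachable input (A.execList l c) := by
  obtain ⟨l₀, rfl⟩ := h
  exact ⟨l₀ ++ l, execList_append ..⟩

theorem Reachable.step {input : Fin n → ℕ} {c : A.Config} (h : A.Reachable input c)
    (p : Fin n) : A.Reachable input (A.step p c) :=
  h.execList [p]

/-! ### Configurations that one process cannot tell apart -/

/-- The configurations `c` and `c'` differ at most in the local state of `q`. -/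
def SimilarExcept (q : Fin n) (c c' : A.Config) : Prop :=
  c.mem = c'.mem ∧ ∀ p, p ≠ q → c.status p = c'.status p

theorem SimilarExcept.step {q p : Fin n} (hp : p ≠ q) {c c' : A.Config}
    (h : SimilarExcept q c c') : SimilarExcept q (A.step p c) (A.step p c') := by
  obtain ⟨hm, hs⟩ := h
  have hp' := hs p hp
  refine ⟨?_, fun r hr => ?_⟩
  · unfold RWAlgorithm.step
    rw [hp']
    split
    · exact hm
    · split <;> simp [hm]
  · by_cases hrp : r = p
    · subst hrp
      unfold RWAlgorithm.step
      rw [hp']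
      split
      · exact hs r hr
      · split <;> simp [hm]
    · rw [step_status_of_ne hrp, step_status_of_ne hrp, hs r hr]

theorem SimilarExcept.execList {q : Fin n} {l : List (Fin n)} (hl : q ∉ l) {c c' : A.Config}
    (h : SimilarExcept q c c') : SimilarExcept q (A.execList l c) (A.execList l c') := by
  induction l generalizing c c' with
  | nil => exact h
  | cons p l ih =>
    rw [List.mem_cons, not_or] at hl
    exact ih hl.2 (h.step (Ne.symm hl.1))

/-- A step that leaves the memory alone is noticed only by the process that takes it. -/
theorem similarExcept_step_of_mem_eq {q : Fin n} {c : A.Config}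
    (h : (A.step q c).mem = c.mem) : SimilarExcept q c (A.step q c) :=
  ⟨h.symm, fun _ hp => (step_status_of_ne hp c).symm⟩

open Classical in
theorem step_write {p : Fin n} {c : A.Config} {s : A.State} {r : A.Reg} {x : A.Val}
    {next : A.State} (hs : c.status p = .running s) (hc : A.code p s = .write r x next) :
    A.step p c = ⟨Function.update c.status p (.running next),
      Function.update c.mem r x⟩ := by
  unfold step
  rw [hs]
  simp only [hc]

/-- Unless `p` is about to write, its step leaves the memory alone, whatever the other processes
have done. -/
theorem poised_to_write_or_step_mem_eq (p : Fin n) (c : A.Config) :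
    (∃ s r x next, c.status p = .running s ∧ A.code p s = .write r x next) ∨
      ∀ c' : A.Config, c'.status p = c.status p → (A.step p c').mem = c'.mem := by
  cases hs : c.status p with
  | terminated v => exact Or.inr fun c' hc' => by rw [step_of_terminated hc']
  | running s =>
    cases hc : A.code p s with
    | write r x next => exact Or.inl ⟨s, r, x, next, rfl, hc⟩
    | _ => exact Or.inr fun c' hc' => by simp [step, hc', hc]

/-- Steps of two processes commute (writes to different registers), or the step of `q` is unnoticed
by the others once `p` has moved (it was no write, or `p` overwrites it), or the order is noticed by
`p` only (as `p` does not write). -/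
theorem step_step_similar {p q : Fin n} (hpq : p ≠ q) (c : A.Config) :
    A.step p (A.step q c) = A.step q (A.step p c) ∨
      SimilarExcept q (A.step p c) (A.step p (A.step q c)) ∨
      SimilarExcept p (A.step q (A.step p c)) (A.step p (A.step q c)) := by
  classical
  rcases poised_to_write_or_step_mem_eq q c with ⟨sq, rq, xq, nq, hsq, hcq⟩ | hq
  swap
  · exact Or.inr (Or.inl ((similarExcept_step_of_mem_eq (hq c rfl)).step hpq))
  rcases poised_to_write_or_step_mem_eq p c with ⟨sp, rp, xp, np, hsp, hcp⟩ | hp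
  swap
  · right; right
    have h₁ := (similarExcept_step_of_mem_eq (hp c rfl)).step hpq.symm
    have h₂ := similarExcept_step_of_mem_eq (hp (A.step q c) (step_status_of_ne hpq c))
    exact ⟨h₁.1.symm.trans h₂.1, fun r hr => (h₁.2 r hr).symm.trans (h₂.2 r hr)⟩
  · have hsp' : (A.step q c).status p = .running sp := by rw [step_status_of_ne hpq, hsp]
    have hsq' : (A.step p c).status q = .running sq := by rw [step_status_of_ne hpq.symm, hsq]
    by_cases hr : rp = rq
    · subst hr
      right; left
      rw [step_write hsp' hcp, step_write hsp hcp, step_write hsq hcq]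
      refine ⟨by simp, fun r hr => ?_⟩
      by_cases hrp : r = p
      · subst hrp; simp
      · simp [hrp, hr]
    · left
      rw [step_write hsp' hcp, step_write hsq' hcq, step_write hsp hcp, step_write hsq hcq]
      simp only
      rw [Function.update_comm hpq, Function.update_comm hr]

/-! ### The collective output and its valency -/

/-- More than `n - k` processes have decided `v` in `c`. In an algorithm for `(n, k)`-partial
agreement, the value from which at most `n - k` processes deviate is then `v`, in every
continuation. -/
def Outputs (k : ℕ) (c : A.Config) (v : ℕ) : Prop :=
  n < {p | c.status p = .terminated v}.ncard + k

/-- Some continuation of `c` outputs `v`. -/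
def CanOutput (k : ℕ) (c : A.Config) (v : ℕ) : Prop :=
  ∃ l, Outputs k (A.execList l c) v

/-- Both binary values are still possible outputs. -/
def Bivalent (k : ℕ) (c : A.Config) : Prop :=
  CanOutput k c 0 ∧ CanOutput k c 1

theorem Outputs.execList {k v : ℕ} {c : A.Config} (h : Outputs k c v) (l : List (Fin n)) :
    Outputs k (A.execList l c) v := by
  have : {p | c.status p = .terminated v} ⊆ {p | (A.execList l c).status p = .terminated v} :=
    fun _ hp => execList_status_terminated l hp
  have := Set.ncard_le_ncard this
  unfold Outputs at *
  omega

theorem CanOutput.of_execList {k v : ℕ} {c : A.Config} {l : List (Fin n)}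
    (h : CanOutput k (A.execList l c) v) : CanOutput k c v := by
  obtain ⟨l', h⟩ := h
  exact ⟨l ++ l', by rwa [execList_append]⟩

theorem CanOutput.of_step {k v : ℕ} {c : A.Config} {p : Fin n}
    (h : CanOutput k (A.step p c) v) : CanOutput k c v :=
  CanOutput.of_execList (l := [p]) h

section Solves

variable {k t : ℕ} {val : Validity} {input : Fin n → ℕ}

/-- At most one value can be output, and it is a proposed one. -/
theorem exists_proposed_forall_outputs (h : SolvesPartialAgreement A.runs 2 k t val)
    (hin : ∀ p, input p < 2) {c : A.Config} (hc : A.Reachable input c) :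
    ∃ w, (∃ p, input p = w) ∧ ∀ v, Outputs k c v → v = w := by
  obtain ⟨l, rfl⟩ := hc
  have hpre : (List.range l.length).filterMap (fun i => l[i]?) = l :=
    filterMap_range_length fun _ _ => rfl
  obtain ⟨⟨w, hagr, hval⟩, -⟩ := h _ ⟨input, fun i => l[i]?, rfl⟩ hin
  refine ⟨w, ?_, fun v hv => ?_⟩
  · cases val
    · exact hval
    · exact hval.1
  · by_contra hvw
    have hsub : {p | (A.execList l (A.initial input)).status p = .terminated v} ⊆
        {p | ∃ u, u ≠ w ∧ (A.run input fun i => l[i]?).Decides p u} := by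
      intro p hp
      refine ⟨v, hvw, l.length, ?_⟩
      rw [run, Status.decision_eq_some, exec_eq_execList, hpre]
      exact hp
    have := Set.ncard_le_ncard hsub
    unfold Outputs at hv
    unfold Run.Agreement at hagr
    omega

theorem Outputs.unique (h : SolvesPartialAgreement A.runs 2 k t val)
    (hin : ∀ p, input p < 2) {c : A.Config} (hc : A.Reachable input c) {v v' : ℕ}
    (hv : Outputs k c v) (hv' : Outputs k c v') : v = v' := by
  obtain ⟨w, -, hw⟩ := exists_proposed_forall_outputs h hin hc
  rw [hw v hv, hw v' hv']

theorem CanOutput.proposed (h : SolvesPartialAgreement A.runs 2 k t val)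
    (hin : ∀ p, input p < 2) {c : A.Config} (hc : A.Reachable input c) {v : ℕ}
    (hv : CanOutput k c v) : ∃ p, input p = v := by
  obtain ⟨l, hl⟩ := hv
  obtain ⟨w, hw, hw'⟩ := exists_proposed_forall_outputs h hin (hc.execList l)
  rwa [hw' v hl]

theorem CanOutput.lt_two (h : SolvesPartialAgreement A.runs 2 k t val)
    (hin : ∀ p, input p < 2) {c : A.Config} (hc : A.Reachable input c) {v : ℕ}
    (hv : CanOutput k c v) : v < 2 := by
  obtain ⟨p, rfl⟩ := hv.proposed h hin hc
  exact hin p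

theorem Bivalent.not_outputs (h : SolvesPartialAgreement A.runs 2 k t val)
    (hin : ∀ p, input p < 2) {c : A.Config} (hc : A.Reachable input c) (hb : Bivalent k c)
    (v : ℕ) : ¬ Outputs k c v := by
  intro hv
  obtain ⟨⟨l₀, h₀⟩, l₁, h₁⟩ := hb
  have e₀ := (hv.execList l₀).unique h hin (hc.execList l₀) h₀
  have e₁ := (hv.execList l₁).unique h hin (hc.execList l₁) h₁
  omega

/-- If all processes but possibly `q` take infinitely many steps, then these processes alone
produce an output: with at most one crash all of them decide, at most `n - k` of them deviate from
the common value, and `n - 1 - (n - k) > n - k`. -/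
theorem exists_outputs_without (h : SolvesPartialAgreement A.runs 2 k t val) (ht : 1 ≤ t)
    (hk : n + 2 ≤ 2 * k) (hin : ∀ p, input p < 2) (q : Fin n) {σ : ℕ → Option (Fin n)}
    (hσ : ∀ p, p ≠ q → {i | σ i = some p}.Infinite) :
    ∃ i v, n < {p | p ≠ q ∧ (A.exec input σ i).status p = .terminated v}.ncard + k := by
  obtain ⟨⟨w, hagr, -⟩, hres⟩ := h _ ⟨input, σ, rfl⟩ hin
  have hlive : ∀ p, p ≠ q → ¬ (A.run input σ).Crashes p := fun p hp hcr => hσ p hp hcr.2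
  have hcrash : {p | (A.run input σ).Crashes p}.ncard ≤ t := by
    have hsub : {p | (A.run input σ).Crashes p} ⊆ {q} := fun p hp => by
      by_contra hpq
      exact hlive p hpq hp
    have := Set.ncard_le_ncard hsub
    rw [Set.ncard_singleton] at this
    omega
  have hdec : ∀ p, ∃ i, p ≠ q → ∃ v, (A.exec input σ i).status p = .terminated v := by
    intro p
    by_cases hp : p = q
    · exact ⟨0, fun h => absurd hp h⟩
    · obtain ⟨v, i, hi⟩ := hres hcrash p (hlive p hp)
      rw [run, Status.decision_eq_some] at hi
      exact ⟨i, fun _ => ⟨v, hi⟩⟩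
  choose f hf using hdec
  refine ⟨Finset.univ.sup f, w, ?_⟩
  set I := Finset.univ.sup f
  have hcover : (Set.univ : Set (Fin n)) ⊆
      ({p | p ≠ q ∧ (A.exec input σ I).status p = .terminated w} ∪
        {p | ∃ u, u ≠ w ∧ (A.run input σ).Decides p u}) ∪ {q} := by
    intro p _
    by_cases hp : p = q
    · exact Or.inr hp
    · left
      obtain ⟨v, hv⟩ := hf p hp
      have hI := exec_status_terminated (Finset.le_sup (Finset.mem_univ p) : f p ≤ I) hv
      by_cases hvw : v = w
      · exact Or.inl ⟨hp, hvw ▸ hI⟩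
      · exact Or.inr ⟨v, hvw, I, Status.decision_eq_some.2 hI⟩
  have h₁ := Set.ncard_le_ncard hcover
  have h₂ := h₁.trans (Set.ncard_union_le _ _)
  have h₃ := Set.ncard_union_le {p | p ≠ q ∧ (A.exec input σ I).status p = .terminated w}
    {p | ∃ u, u ≠ w ∧ (A.run input σ).Decides p u}
  rw [Set.ncard_univ, Nat.card_fin, Set.ncard_singleton] at h₂
  unfold Run.Agreement at hagr
  omega

theorem Reachable.exists_execList_without (h : SolvesPartialAgreement A.runs 2 k t val)
    (ht : 1 ≤ t) (hk : n + 2 ≤ 2 * k) (hin : ∀ p, input p < 2) {c : A.Config}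
    (hc : A.Reachable input c) (q : Fin n) :
    ∃ l v, q ∉ l ∧ n < {p | p ≠ q ∧ (A.execList l c).status p = .terminated v}.ncard + k := by
  obtain ⟨l₀, rfl⟩ := hc
  -- First the steps of `l₀`, then a round robin from which `q` is left out.
  let τ : ℕ → Option (Fin n) := fun i =>
    let p : Fin n := ⟨i % n, Nat.mod_lt _ q.pos⟩
    if p = q then none else some p
  let σ : ℕ → Option (Fin n) := fun i =>
    if i < l₀.length then l₀[i]? else τ (i - l₀.length)
  have hτ : ∀ p, p ≠ q → {i | σ i = some p}.Infinite := by
    intro p hp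
    refine Set.infinite_of_forall_exists_gt fun a => ⟨l₀.length + (n * (a + 1) + p), ?_, ?_⟩
    · have : (⟨(n * (a + 1) + p) % n, Nat.mod_lt _ q.pos⟩ : Fin n) = p := by
        ext
        simp [Nat.mod_eq_of_lt p.2]
      simp [σ, τ, Nat.mod_eq_of_lt p.2, hp]
    · have := Nat.mul_le_mul_right (a + 1) q.pos
      omega
  obtain ⟨i, v, hi⟩ := exists_outputs_without h ht hk hin q hτ
  refine ⟨(List.range i).filterMap τ, v, ?_, ?_⟩
  · intro hq
    obtain ⟨j, -, hj⟩ := List.mem_filterMap.1 hq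
    simp only [τ] at hj
    split at hj
    · cases hj
    · next hne => exact hne (Option.some_injective _ hj)
  · have hpre : (List.range (l₀.length + i)).filterMap σ = l₀ ++ (List.range i).filterMap τ := by
      rw [List.range_add, List.filterMap_append, List.filterMap_map,
        filterMap_range_length fun j hj => if_pos hj]
      congr 2
      funext j
      simp [σ]
    refine hi.trans_le (Nat.add_le_add_right (Set.ncard_le_ncard ?_) _)
    rintro p ⟨hp, hpi⟩
    refine ⟨hp, ?_⟩
    rw [← execList_append, ← hpre, ← exec_eq_execList]
    exact exec_status_terminated (Nat.le_add_left _ _) hpi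

theorem Reachable.exists_canOutput (h : SolvesPartialAgreement A.runs 2 k t val) (ht : 1 ≤ t)
    (hk : n + 2 ≤ 2 * k) (hin : ∀ p, input p < 2) {c : A.Config}
    (hc : A.Reachable input c) (q : Fin n) : ∃ v, CanOutput k c v := by
  obtain ⟨l, v, -, hv⟩ := hc.exists_execList_without h ht hk hin q
  refine ⟨v, l, hv.trans_le (Nat.add_le_add_right (Set.ncard_le_ncard ?_) _)⟩
  exact fun p hp => hp.2

/-- Let `q` pause: the other processes proceed in the same way from `c` and from `c'`, and
produce the same output. -/
theorem SimilarExcept.exists_canOutput (h : SolvesPartialAgreement A.runs 2 k t val) (ht : 1 ≤ t)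
    (hk : n + 2 ≤ 2 * k) (hin : ∀ p, input p < 2) {c c' : A.Config} {q : Fin n}
    (hc : A.Reachable input c) (hs : SimilarExcept q c c') :
    ∃ v, CanOutput k c v ∧ CanOutput k c' v := by
  obtain ⟨l, v, hl, hv⟩ := hc.exists_execList_without h ht hk hin q
  refine ⟨v, ⟨l, hv.trans_le (Nat.add_le_add_right (Set.ncard_le_ncard ?_) _)⟩,
    ⟨l, hv.trans_le (Nat.add_le_add_right (Set.ncard_le_ncard ?_) _)⟩⟩
  · exact fun p hp => hp.2
  · exact fun p hp => ((hs.execList hl).2 p hp.1).symm.trans hp.2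

/-! ### Bivalence can be preserved forever -/

/-- The configurations that a step of `p` leads to before and after a step of `q` have a possible
output in common. So they have the same valency, if both are univalent. -/
theorem exists_canOutput_step_step (h : SolvesPartialAgreement A.runs 2 k t val) (ht : 1 ≤ t)
    (hk : n + 2 ≤ 2 * k) (hin : ∀ p, input p < 2) {c : A.Config} (hc : A.Reachable input c)
    (p q : Fin n) :
    ∃ v, CanOutput k (A.step p c) v ∧ CanOutput k (A.step p (A.step q c)) v := by
  by_cases hpq : p = q
  · subst hpq
    obtain ⟨v, hv⟩ := ((hc.step p).step p).exists_canOutput h ht hk hin p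
    exact ⟨v, hv.of_step, hv⟩
  rcases step_step_similar hpq c with heq | hs | hs
  · obtain ⟨v, hv⟩ := ((hc.step q).step p).exists_canOutput h ht hk hin p
    refine ⟨v, ?_, hv⟩
    rw [heq] at hv
    exact hv.of_step
  · exact hs.exists_canOutput h ht hk hin (hc.step p)
  · obtain ⟨v, hv, hv'⟩ := hs.exists_canOutput h ht hk hin ((hc.step p).step q)
    exact ⟨v, hv.of_step, hv'⟩

/-- A bivalent configuration has a bivalent continuation in which `p` takes the last step. If all
`A.step p (A.execList l c)` were univalent, then by `exists_canOutput_step_step` they would all have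
the valency of `A.step p c`; but `p` cannot undo an output, so both valencies occur. -/
theorem Bivalent.exists_step (h : SolvesPartialAgreement A.runs 2 k t val) (ht : 1 ≤ t)
    (hk : n + 2 ≤ 2 * k) (hin : ∀ p, input p < 2) {c : A.Config} (hc : A.Reachable input c)
    (hb : Bivalent k c) (p : Fin n) : ∃ l, Bivalent k (A.step p (A.execList l c)) := by
  by_contra! hno
  have key : ∀ l v, CanOutput k (A.step p (A.execList l c)) v → CanOutput k (A.step p c) v := by
    intro l
    induction l using List.reverseRecOn with
    | nil => exact fun v hv => hv
    | append_singleton l q ih =>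
      intro v hv
      rw [execList_append] at hv
      obtain ⟨w, hw, hw'⟩ := exists_canOutput_step_step h ht hk hin (hc.execList l) p q
      have hr := ((hc.execList l).step q).step p
      have hv2 := hv.lt_two h hin hr
      have hw2 := hw'.lt_two h hin hr
      have hvw : v = w := by
        by_contra hne
        refine hno (l ++ [q]) ?_
        rw [execList_append]
        obtain ⟨rfl, rfl⟩ | ⟨rfl, rfl⟩ : (v = 0 ∧ w = 1) ∨ (v = 1 ∧ w = 0) := by omega
        · exact ⟨hv, hw'⟩
        · exact ⟨hw', hv⟩
      exact ih v (hvw ▸ hw)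
  obtain ⟨⟨l₀, h₀⟩, l₁, h₁⟩ := hb
  exact hno [] ⟨key l₀ 0 ⟨[], h₀.execList [p]⟩, key l₁ 1 ⟨[], h₁.execList [p]⟩⟩

/-- Change the inputs from all `0` to all `1` one process at a time: the possible outputs of two
neighbouring initial configurations overlap, as the process that tells them apart may pause. -/
theorem exists_bivalent_initial (h : SolvesPartialAgreement A.runs 2 k t val) (ht : 1 ≤ t)
    (hk : n + 2 ≤ 2 * k) (hn : 0 < n) :
    ∃ input : Fin n → ℕ, (∀ p, input p < 2) ∧ Bivalent k (A.initial input) := by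
  by_contra! hno
  let x : ℕ → Fin n → ℕ := fun j p => if p.val < j then 1 else 0
  have hx : ∀ j p, x j p < 2 := fun j p => by simp only [x]; split <;> omega
  have key : ∀ j, j ≤ n → ¬ CanOutput k (A.initial (x j)) 1 := by
    intro j
    induction j with
    | zero =>
      intro _ h1
      obtain ⟨p, hp⟩ := h1.proposed h (hx 0) (reachable_initial _)
      simp [x] at hp
    | succ j ih =>
      intro hj h1
      have hs : SimilarExcept ⟨j, hj⟩ (A.initial (x j)) (A.initial (x (j + 1))) := by
        refine ⟨rfl, fun p hp => ?_⟩
        have : p.val ≠ j := fun h => hp (Fin.ext h)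
        have : x j p = x (j + 1) p := by
          simp only [x]
          congr 1
          simp only [eq_iff_iff]
          omega
        simp only [initial, this]
      obtain ⟨v, hv, hv'⟩ := hs.exists_canOutput h ht hk (hx j) (reachable_initial _)
      have hv2 := hv.lt_two h (hx j) (reachable_initial _)
      have hv1 : v ≠ 1 := fun e => ih (by omega) (e ▸ hv)
      obtain rfl : v = 0 := by omega
      exact hno _ (hx (j + 1)) ⟨hv', h1⟩
  obtain ⟨v, hv⟩ := (reachable_initial (x n)).exists_canOutput h ht hk (hx n) ⟨0, hn⟩
  obtain ⟨p, hp⟩ := hv.proposed h (hx n) (reachable_initial _)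
  have : v = 1 := by simpa [x] using hp.symm
  exact key n le_rfl (this ▸ hv)

/-- There is an infinite schedule that lets every process take infinitely many steps and all of
whose configurations are bivalent, hence never output anything. -/
theorem not_solvesPartialAgreement (hn : 0 < n) (ht : 1 ≤ t) (hk : n + 2 ≤ 2 * k) :
    ¬ SolvesPartialAgreement A.runs 2 k t val := by
  intro h
  obtain ⟨input, hin, hb⟩ := exists_bivalent_initial h ht hk hn
  let turn : ℕ → Fin n := fun s => ⟨s % n, Nat.mod_lt _ hn⟩
  have hext : ∀ (s : ℕ) (l : {l // Bivalent k (A.execList l (A.initial input))}),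
      ∃ l', Bivalent k (A.execList (l.1 ++ l' ++ [turn s]) (A.initial input)) := by
    intro s l
    obtain ⟨l', hl'⟩ := l.2.exists_step h ht hk hin ⟨l.1, rfl⟩ (turn s)
    exact ⟨l', by simpa using hl'⟩
  choose ext hext using hext
  -- `L s` schedules the first `s` stages; stage `s` ends with a step of `turn s`.
  let L : ℕ → {l // Bivalent k (A.execList l (A.initial input))} :=
    fun s => Nat.rec ⟨[], hb⟩ (fun s l => ⟨l.1 ++ ext s l ++ [turn s], hext s l⟩) s
  have hL : ∀ s, (L (s + 1)).1 = (L s).1 ++ ext s (L s) ++ [turn s] := fun s => rfl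
  have hpre : ∀ s s', s ≤ s' → (L s).1 <+: (L s').1 := by
    intro s s' hs
    induction s', hs using Nat.le_induction with
    | base => exact List.prefix_rfl
    | succ s' _ ih =>
      rw [hL, List.append_assoc]
      exact ih.trans (List.prefix_append _ _)
  have hlen : ∀ s, s ≤ (L s).1.length := by
    intro s
    induction s with
    | zero => exact Nat.zero_le _
    | succ s ih =>
      rw [hL]
      simp only [List.length_append, List.length_singleton]
      omega
  let σ : ℕ → Option (Fin n) := fun i => (L (i + 1)).1[i]?
  have hσ : ∀ s i, i < (L s).1.length → σ i = (L s).1[i]? := by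
    intro s i hi
    have hi' : i < (L (i + 1)).1.length := hlen (i + 1)
    rcases le_total s (i + 1) with hs | hs
    · obtain ⟨r, hr⟩ := hpre s (i + 1) hs
      simp only [σ]
      rw [← hr, List.getElem?_append_left hi]
    · obtain ⟨r, hr⟩ := hpre (i + 1) s hs
      simp only [σ]
      rw [← hr, List.getElem?_append_left hi']
  have hfair : ∀ p, {i | σ i = some p}.Infinite := by
    intro p
    refine Set.infinite_of_forall_exists_gt fun a => ?_
    set s := n * (a + 1) + p
    have hs : turn s = p := by
      ext
      simp [turn, s, Nat.mod_eq_of_lt p.2]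
    have hl : (L (s + 1)).1.length = ((L s).1 ++ ext s (L s)).length + 1 := by
      simp [hL, Nat.add_assoc]
    refine ⟨((L s).1 ++ ext s (L s)).length, ?_, ?_⟩
    · change σ _ = some p
      rw [hσ (s + 1) _ (by omega), hL, List.getElem?_concat_length, hs]
    · have := hlen s
      have := Nat.mul_le_mul_right (a + 1) hn
      rw [List.length_append]
      omega
  obtain ⟨i, v, hi⟩ := exists_outputs_without h ht hk hin ⟨0, hn⟩ fun p _ => hfair p
  have hout : Outputs k (A.exec input σ i) v :=
    hi.trans_le (Nat.add_le_add_right (Set.ncard_le_ncard fun p hp => hp.2) _)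
  have hout' : Outputs k (A.exec input σ (L i).1.length) v := by
    refine hout.trans_le (Nat.add_le_add_right (Set.ncard_le_ncard fun p hp => ?_) _)
    exact exec_status_terminated (hlen i) hp
  rw [exec_eq_execList, filterMap_range_length (hσ i)] at hout'
  exact (L i).2.not_outputs h hin ⟨_, rfl⟩ v hout'

end Solves

end RWAlgorithm

/-! ### Simulating message passing by registers -/

namespace MPAlgorithm

variable {n : ℕ} {A : MPAlgorithm n}

/-- Local state of a process of `A.simulation`: a local state of `A`, together with the history of
all send instructions executed so far, the number `turn` of receive instructions executed so far,
and for each process the number `ptr` of its send instructions that have been read. -/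
structure SimState (A : MPAlgorithm n) where
  state : A.State
  sent : List (Fin n → Option A.Msg)
  turn : ℕ
  ptr : Fin n → ℕ

/-- The process that is polled at the next receive instruction of `p`. -/
def polled (p : Fin n) (s : SimState A) : Fin n := ⟨s.turn % n, Nat.mod_lt _ p.pos⟩

/-- The message that `p` extracts at a receive instruction from the history `hist` of the polled
process `q`, if any: the one that the first unread send instruction has for `p`. -/
def extract (p q : Fin n) (s : SimState A) (hist : List (Fin n → Option A.Msg)) :
    Option (Fin n × A.Msg) :=
  hist[s.ptr q]?.bind fun out => (out p).map (Prod.mk q)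

/-- The local state after a receive instruction in which the history `hist` of `q` was read. -/
def afterPoll (p q : Fin n) (s : SimState A) (hist : List (Fin n → Option A.Msg))
    (next : Option (Fin n × A.Msg) → A.State) : SimState A where
  state := next (extract p q s hist)
  sent := s.sent
  turn := s.turn + 1
  ptr := if s.ptr q < hist.length then Function.update s.ptr q (s.ptr q + 1) else s.ptr

/-- The read/write algorithm that simulates `A` step by step. Register `q` holds the history of all
send instructions of `q`. A send instruction is simulated by one write to the own register, and a
receive instruction by one read of a register, all registers being polled in turn. -/
abbrev simulation (A : MPAlgorithm n) : RWAlgorithm n where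
  Reg := Fin n
  Val := List (Fin n → Option A.Msg)
  State := SimState A
  regInit _ := []
  start p v := ⟨A.start p v, [], 0, fun _ => 0⟩
  code p s :=
    match A.code p s.state with
    | .send out next => .write p (s.sent ++ [out]) ⟨next, s.sent ++ [out], s.turn, s.ptr⟩
    | .receive next => .read (polled p s) fun hist => afterPoll p (polled p s) s hist next
    | .compute next => .compute ⟨next, s.sent, s.turn, s.ptr⟩
    | .decide v => .decide v

/-- The messages to `p` in the history `hist` of `q`, apart from the first `i` send
instructions. -/
def pending (p q : Fin n) (hist : List (Fin n → Option A.Msg)) (i : ℕ) :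
    Multiset (Fin n × A.Msg) :=
  ((hist.drop i).filterMap fun out => (out p).map (Prod.mk q) : List (Fin n × A.Msg))

theorem pending_append {p q : Fin n} {hist : List (Fin n → Option A.Msg)} {i : ℕ}
    (hi : i ≤ hist.length) (out : Fin n → Option A.Msg) :
    pending p q (hist ++ [out]) i =
      (out p).elim (pending p q hist i) fun m => (q, m) ::ₘ pending p q hist i := by
  unfold pending
  rw [List.drop_append_of_le_length hi, List.filterMap_append, ← Multiset.coe_add]
  cases h : out p with
  | none => simp [h]
  | some m => simp [h, add_comm, ← Multiset.singleton_add]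

theorem pending_of_extract {p q : Fin n} {s : SimState A} {hist : List (Fin n → Option A.Msg)}
    (h : s.ptr q < hist.length) :
    pending p q hist (s.ptr q) =
      (extract p q s hist).elim (pending p q hist (s.ptr q + 1))
        fun y => y ::ₘ pending p q hist (s.ptr q + 1) := by
  unfold pending extract
  rw [List.drop_eq_getElem_cons h, List.getElem?_eq_getElem h]
  simp only [Option.bind_some, List.filterMap_cons]
  cases hm : hist[s.ptr q] p <;> rfl

/-- The history that `q` has written to its register. -/
def history (c : A.simulation.Config) (q : Fin n) : List (Fin n → Option A.Msg) := c.mem q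

/-- The message that `p` would extract if it executed a receive instruction. -/
def offered (p : Fin n) (c : A.simulation.Config) : Option (Fin n × A.Msg) :=
  match c.status p with
  | .terminated _ => none
  | .running s => extract p (polled p s) s (history c (polled p s))

section Steps

variable {p : Fin n} {c : A.simulation.Config} {s : SimState A} {next : A.State}

theorem simulation_step_send {out : Fin n → Option A.Msg} (hs : c.status p = .running s)
    (hc : A.code p s.state = .send out next) :
    (A.simulation.step p c).status p = .running ⟨next, s.sent ++ [out], s.turn, s.ptr⟩ ∧
      ∀ q, history (A.simulation.step p c) q =
        if q = p then s.sent ++ [out] else history c q := by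
  have hc' : A.simulation.code p s =
      .write p (s.sent ++ [out]) ⟨next, s.sent ++ [out], s.turn, s.ptr⟩ := by
    simp only [hc]
  unfold history
  rw [RWAlgorithm.step_write hs hc']
  refine ⟨by simp, fun q => ?_⟩
  by_cases hq : q = p
  · subst hq; simp
  · simp [hq]

theorem simulation_step_receive {next : Option (Fin n × A.Msg) → A.State}
    (hs : c.status p = .running s) (hc : A.code p s.state = .receive next) :
    (A.simulation.step p c).status p =
        .running (afterPoll p (polled p s) s (history c (polled p s)) next) ∧
      ∀ q, history (A.simulation.step p c) q = history c q := by
  unfold RWAlgorithm.step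
  rw [hs]
  simp only [hc]
  exact ⟨Function.update_self .., fun _ => rfl⟩

theorem simulation_step_compute (hs : c.status p = .running s)
    (hc : A.code p s.state = .compute next) :
    (A.simulation.step p c).status p = .running ⟨next, s.sent, s.turn, s.ptr⟩ ∧
      ∀ q, history (A.simulation.step p c) q = history c q := by
  unfold RWAlgorithm.step
  rw [hs]
  simp only [hc]
  exact ⟨Function.update_self .., fun _ => rfl⟩

theorem simulation_step_decide {v : ℕ} (hs : c.status p = .running s)
    (hc : A.code p s.state = .decide v) :
    (A.simulation.step p c).status p = .terminated v ∧
      ∀ q, history (A.simulation.step p c) q = history c q := by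
  unfold RWAlgorithm.step
  rw [hs]
  simp only [hc]
  exact ⟨Function.update_self .., fun _ => rfl⟩

end Steps

/-- The configuration `c` of the simulation represents the configuration `d` of `A` as far as `p`
is concerned. Nothing is required of the buffer of a terminated process. -/
def RepresentsAt (c : A.simulation.Config) (d : A.Config) (p : Fin n) : Prop :=
  (∃ v, c.status p = .terminated v ∧ d.status p = .terminated v) ∨
    ∃ s : SimState A, c.status p = .running s ∧ d.status p = .running s.state ∧
      history c p = s.sent ∧ (∀ q, s.ptr q ≤ (history c q).length) ∧
      d.buffer p = ∑ q, pending p q (history c q) (s.ptr q)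

/-- The configuration `c` of the simulation represents the configuration `d` of `A`. -/
def Represents (c : A.simulation.Config) (d : A.Config) : Prop :=
  ∀ p, RepresentsAt c d p

theorem represents_initial (input : Fin n → ℕ) :
    Represents (A.simulation.initial input) (A.initial input) :=
  fun p => Or.inr ⟨⟨A.start p (input p), [], 0, fun _ => 0⟩, rfl, rfl, rfl, fun _ => Nat.zero_le _,
    by simp [initial, RWAlgorithm.initial, history, pending]⟩

theorem lt_length_of_extract {p q : Fin n} {s : SimState A} {hist : List (Fin n → Option A.Msg)}
    {y : Fin n × A.Msg} (h : extract p q s hist = some y) : s.ptr q < hist.length := by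
  by_contra hge
  simp [extract, List.getElem?_eq_none (not_lt.1 hge)] at h

theorem offered_mem_buffer {p : Fin n} {c : A.simulation.Config} {d : A.Config}
    (h : Represents c d) {y : Fin n × A.Msg} (hy : offered p c = some y) : y ∈ d.buffer p := by
  rcases h p with ⟨v, hv, -⟩ | ⟨s, hs, -, -, -, hbuf⟩
  · simp [offered, hv] at hy
  · simp only [offered, hs] at hy
    rw [hbuf, Multiset.mem_sum]
    refine ⟨polled p s, Finset.mem_univ _, ?_⟩
    rw [pending_of_extract (lt_length_of_extract hy), hy, Option.elim_some]
    exact Multiset.mem_cons_self _ _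

theorem step_status_of_ne {p q : Fin n} (h : q ≠ p) (x : Option (Fin n × A.Msg)) (d : A.Config) :
    (A.step p x d).status q = d.status q := by
  unfold step
  split
  · rfl
  · split
    · simp [h]
    · split
      · simp [h]
      · split <;> simp [h]
    · simp [h]
    · simp [h]

/-- A poll of `r` removes the extracted message from the messages pending at `p`. -/
theorem sum_pending_afterPoll {p r : Fin n} {s : SimState A}
    {hist : Fin n → List (Fin n → Option A.Msg)} (next : Option (Fin n × A.Msg) → A.State) :
    ∑ q, pending p q (hist q) (s.ptr q) =
      (extract p r s (hist r)).elim 0 (fun y => {y}) +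
        ∑ q, pending p q (hist q) ((afterPoll p r s (hist r) next).ptr q) := by
  classical
  by_cases hlt : s.ptr r < (hist r).length
  · rw [← Finset.add_sum_erase _ _ (Finset.mem_univ r),
      ← Finset.add_sum_erase _ (fun q => pending p q (hist q) _) (Finset.mem_univ r),
      pending_of_extract hlt, ← add_assoc]
    congr 1
    · simp only [afterPoll, hlt, if_true, Function.update_self]
      cases extract p r s (hist r) <;> simp
    · refine Finset.sum_congr rfl fun q hq => ?_
      simp [afterPoll, hlt, Finset.ne_of_mem_erase hq]
  · have : extract p r s (hist r) = none := by
      cases he : extract p r s (hist r) with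
      | none => rfl
      | some y => exact absurd (lt_length_of_extract he) hlt
    simp [this, afterPoll, hlt]

theorem Represents.step {p : Fin n} {c : A.simulation.Config} {d : A.Config}
    (h : Represents c d) :
    Represents (A.simulation.step p c) (A.step p (offered p c) d) := by
  have hoff := fun y => offered_mem_buffer (p := p) h (y := y)
  rcases h p with ⟨v, hv, hv'⟩ | ⟨s, hs, hs', hsent, hptr, hbuf⟩
  · simpa [RWAlgorithm.step, MPAlgorithm.step, hv, hv'] using h
  have hother : (∀ q, history (A.simulation.step p c) q = history c q) →
      (∀ q, q ≠ p → (A.step p (offered p c) d).buffer q = d.buffer q) →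
      ∀ q, q ≠ p → RepresentsAt (A.simulation.step p c) (A.step p (offered p c) d) q := by
    intro hh hb q hq
    simp only [RepresentsAt, RWAlgorithm.step_status_of_ne hq, step_status_of_ne hq, hh, hb q hq]
    exact h q
  cases hcode : A.code p s.state with
  | send out next =>
    obtain ⟨hst, hh⟩ := simulation_step_send hs hcode
    have hstep : A.step p (offered p c) d = ⟨Function.update d.status p (.running next),
        fun q => (out q).elim (d.buffer q) fun msg => (p, msg) ::ₘ d.buffer q⟩ := by
      unfold MPAlgorithm.step
      simp only [hs', hcode]
    have hlen : ∀ q, (history c q).length ≤ (history (A.simulation.step p c) q).length := by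
      intro q
      rw [hh]
      split
      · next hq => simp [hq, hsent]
      · exact le_rfl
    have hsum : ∀ (q : Fin n) (i : Fin n → ℕ), (∀ r, i r ≤ (history c r).length) →
        d.buffer q = ∑ r, pending q r (history c r) (i r) →
        (A.step p (offered p c) d).buffer q =
          ∑ r, pending q r (history (A.simulation.step p c) r) (i r) := by
      intro q i hi hq
      classical
      rw [← Finset.add_sum_erase _ _ (Finset.mem_univ p)] at hq ⊢
      rw [hh p, if_pos rfl, ← hsent, pending_append (hi p),
        Finset.sum_congr rfl fun r hr => by rw [hh r, if_neg (Finset.ne_of_mem_erase hr)], hstep]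
      simp only [hq]
      cases out q <;> simp
    intro q
    by_cases hq : q = p
    · subst hq
      refine Or.inr ⟨_, hst, by simp [hstep], by simp [hh], fun r => (hptr r).trans (hlen r), ?_⟩
      exact hsum q s.ptr hptr hbuf
    · rcases h q with ⟨v, hv, hv'⟩ | ⟨s', hs₁, hs₂, hs₃, hs₄, hs₅⟩
      · exact Or.inl ⟨v, by rw [RWAlgorithm.step_status_of_ne hq, hv],
          by rw [step_status_of_ne hq, hv']⟩
      · exact Or.inr ⟨s', by rw [RWAlgorithm.step_status_of_ne hq, hs₁],
          by rw [step_status_of_ne hq, hs₂], by rw [hh, if_neg hq, hs₃],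
          fun r => (hs₄ r).trans (hlen r), hsum q s'.ptr hs₄ hs₅⟩
  | receive next =>
    obtain ⟨hst, hh⟩ := simulation_step_receive hs hcode
    have hoff' : offered p c = extract p (polled p s) s (history c (polled p s)) := by
      simp only [offered, hs]
    have hsum := sum_pending_afterPoll (p := p) (r := polled p s) (s := s) (hist := history c) next
    have hst' : (A.step p (offered p c) d).status p = .running (next (offered p c)) := by
      unfold MPAlgorithm.step
      simp only [hs', hcode]
      cases ho : offered p c with
      | none => simp
      | some y => simp [hoff y ho]
    have hbuf' : ∀ q, q ≠ p → (A.step p (offered p c) d).buffer q = d.buffer q := by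
      intro q hq
      unfold MPAlgorithm.step
      simp only [hs', hcode]
      cases ho : offered p c with
      | none => simp
      | some y => simp [hoff y ho, hq]
    have hbufp : d.buffer p =
        (offered p c).elim 0 (fun y => {y}) + (A.step p (offered p c) d).buffer p := by
      unfold MPAlgorithm.step
      simp only [hs', hcode]
      cases ho : offered p c with
      | none => simp
      | some y => simp [hoff y ho, Multiset.cons_erase]
    intro q
    by_cases hq : q = p
    · subst hq
      refine Or.inr ⟨_, hst, by rw [hst', hoff']; rfl, by rw [hh, hsent]; rfl, fun r => ?_, ?_⟩
      · rw [hh]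
        simp only [afterPoll]
        split
        · by_cases hr : r = polled q s
          · subst hr
            rwa [Function.update_self]
          · rw [Function.update_of_ne hr]
            exact hptr r
        · exact hptr r
      · simp only [hh]
        rw [← hbuf, hbufp, hoff'] at hsum
        rw [hoff']
        exact add_left_cancel hsum
    · exact hother hh hbuf' q hq
  | compute next =>
    obtain ⟨hst, hh⟩ := simulation_step_compute hs hcode
    have hstep : A.step p (offered p c) d =
        ⟨Function.update d.status p (.running next), d.buffer⟩ := by
      unfold MPAlgorithm.step
      simp only [hs', hcode]
    intro q
    by_cases hq : q = p
    · subst hq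
      exact Or.inr ⟨_, hst, by simp [hstep], by rw [hh, hsent], by simpa only [hh] using hptr,
        by simpa only [hh, hstep] using hbuf⟩
    · exact hother hh (by simp [hstep]) q hq
  | decide v =>
    obtain ⟨hst, hh⟩ := simulation_step_decide hs hcode
    have hstep : A.step p (offered p c) d =
        ⟨Function.update d.status p (.terminated v), d.buffer⟩ := by
      unfold MPAlgorithm.step
      simp only [hs', hcode]
    intro q
    by_cases hq : q = p
    · subst hq
      exact Or.inl ⟨v, hst, by simp [hstep]⟩
    · exact hother hh (by simp [hstep]) q hq

/-- The schedule of `A` that corresponds to the schedule `σ` of the simulation. -/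
noncomputable def simSchedule (A : MPAlgorithm n) (input : Fin n → ℕ) (σ : ℕ → Option (Fin n)) :
    A.Schedule :=
  fun i => (σ i).map fun p => (p, offered p (A.simulation.exec input σ i))

theorem represents_exec (input : Fin n → ℕ) (σ : ℕ → Option (Fin n)) (i : ℕ) :
    Represents (A.simulation.exec input σ i) (A.exec input (A.simSchedule input σ) i) := by
  induction i with
  | zero => exact represents_initial input
  | succ i ih =>
    rw [exec, RWAlgorithm.exec]
    cases h : σ i with
    | none => simpa [simSchedule, h] using ih
    | some p => simpa [simSchedule, h] using ih.step

/-! ### Fairness of the polling -/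

/-- A sequence that grows by at most one in each step does not jump over the value `T`. -/
theorem exists_eq_of_increments {f : ℕ → ℕ} (hf : ∀ i, f (i + 1) ≤ f i + 1) {i T : ℕ}
    (hi : f i ≤ T) (hT : ∃ j, i ≤ j ∧ T < f j) : ∃ j, i ≤ j ∧ f j = T ∧ f (j + 1) = T + 1 := by
  classical
  obtain ⟨hle, hlt⟩ := Nat.find_spec hT
  obtain ⟨j, hj⟩ : ∃ j, Nat.find hT = j + 1 := by
    refine Nat.exists_eq_succ_of_ne_zero fun h0 => ?_
    rw [h0] at hle hlt
    obtain rfl : i = 0 := by omega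
    omega
  rw [hj] at hle hlt
  have hij : i ≤ j := by
    by_contra hcon
    obtain rfl : i = j + 1 := by omega
    omega
  have : ¬ (i ≤ j ∧ T < f j) := Nat.find_min hT (by omega)
  have := hf j
  exact ⟨j, hij, by omega, by omega⟩

/-- A monotone sequence exceeds `T` if it grows again and again as long as it does not. -/
theorem exists_lt_of_increments {f : ℕ → ℕ} (hf : Monotone f) {i T : ℕ}
    (hinc : ∀ j, i ≤ j → f j ≤ T → ∃ j', j ≤ j' ∧ (f j' ≤ T → f j' < f (j' + 1))) :
    ∃ j, i ≤ j ∧ T < f j := by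
  have key : ∀ v, v ≤ T + 1 → ∃ j, i ≤ j ∧ v ≤ f j := by
    intro v
    induction v with
    | zero => exact fun _ => ⟨i, le_rfl, Nat.zero_le _⟩
    | succ v ih =>
      intro hv
      obtain ⟨j, hij, hj⟩ := ih (by omega)
      by_cases hjT : f j ≤ T
      · obtain ⟨j', hjj', hj'⟩ := hinc j hij hjT
        have := hf hjj'
        by_cases hj'T : f j' ≤ T
        · have := hj' hj'T
          exact ⟨j' + 1, by omega, by omega⟩
        · exact ⟨j', by omega, by omega⟩
      · exact ⟨j, hij, by omega⟩
  exact key (T + 1) le_rfl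

theorem history_prefix_step (p q : Fin n) (c : A.simulation.Config)
    (h : ∀ s : SimState A, c.status p = .running s → history c p = s.sent) :
    history c q <+: history (A.simulation.step p c) q := by
  cases hs : c.status p with
  | terminated v => rw [RWAlgorithm.step_of_terminated hs]
  | running s =>
    cases hc : A.code p (SimState.state s) with
    | send out next =>
      rw [(simulation_step_send hs hc).2 q]
      split
      · next hq =>
        rw [hq, h s hs]
        exact List.prefix_append _ _
      · exact List.prefix_rfl
    | receive next => rw [(simulation_step_receive hs hc).2 q]
    | compute next => rw [(simulation_step_compute hs hc).2 q]
    | decide v => rw [(simulation_step_decide hs hc).2 q]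

theorem history_prefix_exec (input : Fin n → ℕ) (σ : ℕ → Option (Fin n)) (q : Fin n) {i j : ℕ}
    (hij : i ≤ j) :
    history (A.simulation.exec input σ i) q <+: history (A.simulation.exec input σ j) q := by
  induction j, hij using Nat.le_induction with
  | base => exact List.prefix_rfl
  | succ j _ ih =>
    rw [RWAlgorithm.exec]
    cases hp : σ j with
    | none => exact ih
    | some p =>
      refine ih.trans (history_prefix_step p q _ fun s hs => ?_)
      rcases represents_exec input σ j p with ⟨v, hv, -⟩ | ⟨s', hs', -, h, -⟩
      · rw [hv] at hs; cases hs
      · rw [hs'] at hs; cases hs; exact h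

/-- A process that executes receive instructions infinitely often polls every register infinitely
often, and each poll consumes the first unread send instruction. So every message that is in
transit is eventually extracted. -/
theorem reliableDelivery_simSchedule (input : Fin n → ℕ) (σ : ℕ → Option (Fin n)) :
    A.ReliableDelivery input (A.simSchedule input σ) := by
  intro p hinf i y hy
  have hrep := represents_exec (A := A) input σ
  set c := A.simulation.exec input σ with hc
  set d := A.exec input (A.simSchedule input σ)
  -- Process `p` never terminates, as it is at a receive instruction infinitely often.
  have hrun : ∀ i, ∃ s : SimState A, (c i).status p = .running s ∧
      (d i).status p = .running s.state ∧ history (c i) p = s.sent ∧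
      (∀ q, s.ptr q ≤ (history (c i) q).length) ∧
      (d i).buffer p = ∑ q, pending p q (history (c i) q) (s.ptr q) := by
    intro i
    rcases hrep i p with ⟨v, hv, -⟩ | h
    · obtain ⟨j, ⟨x, -, s, next, hs, -⟩, hij⟩ := hinf.exists_gt i
      have hv' := RWAlgorithm.exec_status_terminated hij.le hv
      rcases hrep j p with ⟨w, -, hw⟩ | ⟨s', hs', -⟩
      · exact absurd (hs.symm.trans hw) (by simp)
      · exact absurd (hs'.symm.trans hv') (by simp)
    · exact h
  choose s hst hst' hsent hptr hbuf using hrun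
  -- The instruction that `p` executes in step `i` of the schedule is a receive.
  let R : ℕ → Prop := fun i => σ i = some p ∧ A.AtReceive (d i) p
  have hstep : ∀ i, (R i ∧ ∃ next, s (i + 1) = afterPoll p (polled p (s i)) (s i)
        (history (c i) (polled p (s i))) next) ∨
      (¬ R i ∧ (s (i + 1)).turn = (s i).turn ∧ (s (i + 1)).ptr = (s i).ptr) := by
    intro i
    have hnext := hst (i + 1)
    have hexec : c (i + 1) = match σ i with
      | none => c i
      | some p => A.simulation.step p (c i) := rfl
    rw [hexec] at hnext
    by_cases hσ : σ i = some p
    · simp only [hσ] at hnext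
      have hnotR (h : ∀ next, A.code p (s i).state ≠ .receive next) : ¬ R i := by
        rintro ⟨-, t, next, ht, hnext⟩
        rw [hst' i] at ht
        cases ht
        exact h next hnext
      cases hcode : A.code p (s i).state with
      | send out next =>
        right
        rw [(simulation_step_send (hst i) hcode).1] at hnext
        rw [← Status.running.inj hnext]
        exact ⟨hnotR fun _ h => (by rw [hcode] at h; cases h), rfl, rfl⟩
      | receive next =>
        left
        rw [(simulation_step_receive (hst i) hcode).1] at hnext
        exact ⟨⟨hσ, _, next, hst' i, hcode⟩, next, (Status.running.inj hnext).symm⟩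
      | compute next =>
        right
        rw [(simulation_step_compute (hst i) hcode).1] at hnext
        rw [← Status.running.inj hnext]
        exact ⟨hnotR fun _ h => (by rw [hcode] at h; cases h), rfl, rfl⟩
      | decide v =>
        rw [(simulation_step_decide (hst i) hcode).1] at hnext
        cases hnext
    · right
      have : (c i).status p = .running (s (i + 1)) := by
        rw [← hnext]
        cases hq : σ i with
        | none => rfl
        | some q =>
          refine (RWAlgorithm.step_status_of_ne ?_ _).symm
          rintro rfl
          exact hσ hq
      rw [hst i] at this
      rw [← Status.running.inj this]
      exact ⟨fun h => hσ h.1, rfl, rfl⟩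
  have hRinf : ∀ a, ∃ j, a ≤ j ∧ R j := by
    intro a
    obtain ⟨j, ⟨x, hx, hat⟩, haj⟩ := hinf.exists_gt a
    obtain ⟨p', hp', he⟩ := Option.map_eq_some_iff.1 hx
    exact ⟨j, haj.le, hp'.trans (congrArg some (congrArg Prod.fst he)), hat⟩
  -- Every value of `turn` is reached, so every register is polled again and again.
  have hpoll : ∀ a q, ∃ j, a ≤ j ∧ R j ∧ polled p (s j) = q := by
    intro a q
    have hinc : ∀ i, (s (i + 1)).turn = (s i).turn ∨ (R i ∧ (s (i + 1)).turn = (s i).turn + 1) := by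
      intro i
      rcases hstep i with ⟨hR, next, h⟩ | ⟨-, h, -⟩
      · exact Or.inr ⟨hR, by rw [h]; rfl⟩
      · exact Or.inl h
    have hT : (s a).turn ≤ n * (s a).turn + q :=
      (Nat.le_mul_of_pos_left _ p.pos).trans (Nat.le_add_right _ _)
    obtain ⟨j, haj, hj, hj'⟩ := exists_eq_of_increments (f := fun i => (s i).turn)
      (fun i => by rcases hinc i with h | h <;> omega) hT
      (exists_lt_of_increments
        (monotone_nat_of_le_succ fun i => by rcases hinc i with h | h <;> omega)
        fun j _ _ => by
          obtain ⟨j', hjj', hR⟩ := hRinf j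
          refine ⟨j', hjj', fun _ => ?_⟩
          rcases hstep j' with ⟨-, next, h⟩ | ⟨h, -⟩
          · rw [h]; exact Nat.lt_succ_self _
          · exact absurd hR h)
    refine ⟨j, haj, ?_, ?_⟩
    · rcases hinc j with h | h
      · omega
      · exact h.1
    · ext
      simp only [polled]
      rw [hj]
      simp [Nat.mod_eq_of_lt q.2]
  -- Locate `y` in the history of its sender `q`, at a position that has not been read.
  obtain ⟨q, l, hl, m, hm, rfl⟩ : ∃ q l, (s i).ptr q ≤ l ∧ ∃ m : A.Msg,
      (∃ out, (history (c i) q)[l]? = some out ∧ out p = some m) ∧ (q, m) = y := by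
    rw [hbuf i, Multiset.mem_sum] at hy
    obtain ⟨q, -, hq⟩ := hy
    rw [pending, Multiset.mem_coe, List.mem_filterMap] at hq
    obtain ⟨out, hout, he⟩ := hq
    obtain ⟨m, hm, rfl⟩ := Option.map_eq_some_iff.1 he
    obtain ⟨l, hl⟩ := List.mem_iff_getElem?.1 hout
    rw [List.getElem?_drop] at hl
    exact ⟨q, _, Nat.le_add_right _ _, m, ⟨out, hl, hm⟩, rfl⟩
  obtain ⟨out, hout, hm⟩ := hm
  have hout' : ∀ j, i ≤ j → (history (c j) q)[l]? = some out := by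
    intro j hij
    obtain ⟨r, hr⟩ : history (c i) q <+: history (c j) q := history_prefix_exec input σ q hij
    rw [← hr, List.getElem?_append_left (List.getElem?_eq_some_iff.1 hout).1, hout]
  have hinc : ∀ i, (s (i + 1)).ptr q = (s i).ptr q ∨
      (R i ∧ polled p (s i) = q ∧ (s (i + 1)).ptr q = (s i).ptr q + 1) := by
    intro i
    rcases hstep i with ⟨hR, next, h⟩ | ⟨-, -, h⟩
    · rw [h]
      simp only [afterPoll]
      split
      · by_cases hq : polled p (s i) = q
        · subst hq
          exact Or.inr ⟨hR, rfl, Function.update_self ..⟩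
        · exact Or.inl (Function.update_of_ne (Ne.symm hq) ..)
      · exact Or.inl rfl
    · exact Or.inl (by rw [h])
  obtain ⟨j, hij, hj, hj'⟩ := exists_eq_of_increments (f := fun i => (s i).ptr q)
    (fun i => by rcases hinc i with h | h <;> omega) hl
    (exists_lt_of_increments
      (monotone_nat_of_le_succ fun i => by rcases hinc i with h | h <;> omega)
      fun j hij _ => by
        obtain ⟨j', hjj', hR, hq⟩ := hpoll j q
        refine ⟨j', hjj', fun hle => ?_⟩
        rcases hstep j' with ⟨-, next, h⟩ | ⟨h, -⟩
        · have hlt : l < (history (c j') q).length :=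
            (List.getElem?_eq_some_iff.1 (hout' j' (by omega))).1
          rw [h, hq]
          simp only [afterPoll]
          rw [if_pos (by omega), Function.update_self]
          exact Nat.lt_succ_self _
        · exact absurd hR h)
  have hR : R j ∧ polled p (s j) = q := by
    rcases hinc j with h | h
    · omega
    · exact ⟨h.1, h.2.1⟩
  have hoff : offered p (c j) = some (q, m) := by
    simp only [offered, hst j, hR.2, extract]
    rw [hj, hout' j hij]
    simp [hm]
  refine ⟨j, hij, ?_, hR.1.2, offered_mem_buffer (hrep j) hoff⟩
  rw [simSchedule, hR.1.1, ← hoff]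
  rfl

/-- Every run of the simulation is a run of `A`. -/
theorem simulation_runs_subset (A : MPAlgorithm n) : A.simulation.runs ⊆ A.runs := by
  rintro _ ⟨input, σ, rfl⟩
  refine ⟨input, A.simSchedule input σ, reliableDelivery_simSchedule input σ, ?_⟩
  rw [run, RWAlgorithm.run, Run.mk.injEq]
  refine ⟨rfl, ?_, ?_⟩
  · funext i
    simp [simSchedule, Function.comp_def]
  · funext i p
    rcases represents_exec (A := A) input σ i p with ⟨v, hv, hv'⟩ | ⟨s, hs, hs', -⟩
    · rw [hv, hv']; rfl
    · rw [hs, hs']; rfl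

end MPAlgorithm

/-! ### The characterization -/

theorem theorem1 (n t : ℕ) (hn : 2 ≤ n) (ht : 1 ≤ t) (val : Validity) (k : ℕ) :
    ((∃ A : RWAlgorithm n, SolvesPartialAgreement A.runs 2 k t val) ↔ k ≤ ⌈(n : ℚ) / 2⌉₊) ∧
    ((∃ A : MPAlgorithm n, SolvesPartialAgreement A.runs 2 k t val) ↔ k ≤ ⌈(n : ℚ) / 2⌉₊) ∧
    (k ≤ ⌈(n : ℚ) / 2⌉₊ →
      (∃ A : RWAlgorithm n, A.NoCommunication ∧ OnlyOwnInputDecided A.runs ∧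
        SolvesPartialAgreement A.runs 2 k t val) ∧
      (∃ A : MPAlgorithm n, A.NoCommunication ∧ OnlyOwnInputDecided A.runs ∧
        SolvesPartialAgreement A.runs 2 k t val)) := by
  rw [le_ceil_half_iff]
  have hRW : ∀ A : RWAlgorithm n, SolvesPartialAgreement A.runs 2 k t val → 2 * k ≤ n + 1 := by
    intro A h
    by_contra hk
    exact A.not_solvesPartialAgreement (by omega) ht (by omega) h
  refine ⟨⟨fun ⟨A, h⟩ => hRW A h, fun hk => ⟨_, RWAlgorithm.ownInput_solves hn hk val⟩⟩,
    ⟨fun ⟨A, h⟩ => hRW A.simulation fun r hr => h r (A.simulation_runs_subset hr),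
      fun hk => ⟨_, MPAlgorithm.ownInput_solves hn hk val⟩⟩, fun hk => ⟨?_, ?_⟩⟩
  · exact ⟨_, RWAlgorithm.ownInput_noCommunication n, RWAlgorithm.ownInput_onlyOwnInputDecided n,
      RWAlgorithm.ownInput_solves hn hk val⟩
  · exact ⟨_, MPAlgorithm.ownInput_noCommunication n, MPAlgorithm.ownInput_onlyOwnInputDecided n,
      MPAlgorithm.ownInput_solves hn hk val⟩
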